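/- Let $G$ be a finite cograph (a finite simple graph with no induced path on four vertices) with vertex set $V$. Let $T$ be its cotree, that is, the rooted tree whose leaves are the vertices of $G$ and whose internal nodes are labelled parallel or series, such that every internal node has at least two children, no two parallel nodes are adjacent, no two series nodes are adjacent, and two distinct vertices of $G$ are adjacent iff their lowest common ancestor in $T$ is a series node. Let $x\notin V$ be a new vertex with neighbourhood $N(x)\subseteq V$, where $N(x)\neq\varnothing$ and $N(x)\neq V$, and let $G+x$ be the graph obtained by adding $x$ to $G$. For a node $u$ of $T$ let $T_u$ be the subtree of $T$ rooted at $u$ and let $V(u)$ be the set of its leaves. For a set $N\subseteq V$, a node $u$ is full with respect to $N$ if $V(u)\subseteq N$, hollow if $V(u)\cap N=\varnothing$, uniform if it is full or hollow, and mixed otherwise; when $N$ is not mentioned, $N=N(x)$. - A *completion* of $G+x$ is a cograph obtained from $G+x$ by adding (possibly zero) edges incident to $x$; it is *minimal* if its edge set is inclusion-minimal among all completions of $G+x$. The *insertion node* of a completion in which $x$ has neighbourhood $N'$ is the node $u$ that is mixed with respect to $N'$, all of whose children are uniform with respect to $N'$, and such that for all $y\in V\setminus V(u)$ we have $y\in N'$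 iff the lowest common ancestor of $y$ and $u$ is a series node. (There is at most one such node.) - A node is a *completion-minimal insertion node* if it is the insertion node of some minimal completion of $G+x$. - A node $u$ is *eligible* if for every strict ancestor $v$ of $u$ that is a parallel node, all the children of $v$ other than the one that is $u$ or an ancestor of $u$ are hollow. - A node $u$ is *completion-forced* (inductively) if $u$ is full, or $u$ is a parallel node all of whose children are non-hollow, or $u$ is a series node all of whose children are completion-forced. Then, for every node $u$ of $T$, the subtree $T_u$ (including $u$ itself) contains a completion-minimal insertion node if and only if $u$ is eligible, non-hollow and not completion-forced. -/

import Mathlib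

namespace CographCompletion

universe v w

/-- A cograph is a graph without induced path on four vertices. -/
def IsCograph {V : Type*} (G : SimpleGraph V) : Prop :=
  ¬ (SimpleGraph.pathGraph 4).IsIndContained G

inductive NodeKind
  | leaf
  | parallel
  | series

/-- A cotree of `G`: a finite rooted tree whose leaves are the vertices of `G` and whose internal
nodes are labelled parallel or series. In the order of the rooted tree the root is `⊥`, `u ≤ v`
means that `u` is an ancestor of `v` (possibly `u = v`), `u ⋖ v` means that `v` is a child of `u`,
and `u ⊓ v` is the lowest common ancestor of `u` and `v`. -/
structure Cotree {V : Type v} (G : SimpleGraph V) where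
  tree : RootedTree.{w}
  finite_tree : Finite tree
  kind : tree → NodeKind
  kind_eq_leaf_iff : ∀ u, kind u = NodeKind.leaf ↔ IsMax u
  leaf : V → tree
  leaf_injective : Function.Injective leaf
  range_leaf : Set.range leaf = {u | kind u = NodeKind.leaf}
  two_children : ∀ u, kind u ≠ NodeKind.leaf → ∃ v w, u ⋖ v ∧ u ⋖ w ∧ v ≠ w
  no_adjacent_parallel : ∀ u v, u ⋖ v → kind u = NodeKind.parallel → kind v ≠ NodeKind.parallel
  no_adjacent_series : ∀ u v, u ⋖ v → kind u = NodeKind.series → kind v ≠ NodeKind.series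
  adj_iff : ∀ x y, x ≠ y → (G.Adj x y ↔ kind (leaf x ⊓ leaf y) = NodeKind.series)

/-- The graph `G + x` where the new vertex `x`, written `none`, has neighbourhood `N`. -/
def addVertex {V : Type*} (G : SimpleGraph V) (N : Set V) : SimpleGraph (Option V) where
  Adj
    | none, none => False
    | none, some y => y ∈ N
    | some y, none => y ∈ N
    | some y, some z => G.Adj y z
  symm := ⟨by
    rintro (_ | y) (_ | z) h
    · exact h
    · exact h
    · exact h
    · exact SimpleGraph.Adj.symm (G := G) h⟩
  loopless := ⟨by
    rintro (_ | y) h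
    · exact h
    · exact SimpleGraph.irrefl G h⟩

/-- A (constrained cograph) completion of `G + x`: a cograph obtained from `G + x` by adding
edges that are incident to `x`. -/
def IsCompletion {V : Type*} (G : SimpleGraph V) (N : Set V) (H : SimpleGraph (Option V)) : Prop :=
  addVertex G N ≤ H ∧ (∀ y z : V, H.Adj (some y) (some z) → G.Adj y z) ∧ IsCograph H

/-- The neighbourhood of the new vertex in a graph on `V + x`. -/
def newNeighbors {V : Type*} (H : SimpleGraph (Option V)) : Set V :=
  {y | H.Adj none (some y)}

def IsFull {V : Type*} (N S : Set V) : Prop := S ⊆ N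

def IsHollow {V : Type*} (N S : Set V) : Prop := S ∩ N = ∅

def IsMixed {V : Type*} (N S : Set V) : Prop := ¬ IsFull N S ∧ ¬ IsHollow N S

def IsUniform {V : Type*} (N S : Set V) : Prop := IsFull N S ∨ IsHollow N S

namespace Cotree

variable {V : Type*} {G : SimpleGraph V}

/-- The set `V(u)` of vertices of `G` that are leaves of the subtree rooted at `u`. -/
def verts (T : Cotree G) (u : T.tree) : Set V := {y | u ≤ T.leaf y}

/-- `u` is the insertion node of a new vertex with neighbourhood `N`. -/
def IsInsertionNode (T : Cotree G) (N : Set V) (u : T.tree) : Prop :=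
  IsMixed N (T.verts u) ∧
  (∀ v, u ⋖ v → IsUniform N (T.verts v)) ∧
  ∀ y, y ∉ T.verts u → (y ∈ N ↔ T.kind (T.leaf y ⊓ u) = NodeKind.series)

/-- `u` is the insertion node associated to some inclusion-minimal completion of `G + x`. -/
def IsCompletionMinimalInsertionNode (T : Cotree G) (N : Set V) (u : T.tree) : Prop :=
  ∃ H : SimpleGraph (Option V), Minimal (IsCompletion G N) H ∧
    T.IsInsertionNode (newNeighbors H) u

def IsEligible (T : Cotree G) (N : Set V) (u : T.tree) : Prop :=
  ∀ v, v < u → T.kind v = NodeKind.parallel →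
    ∀ w, v ⋖ w → ¬ w ≤ u → IsHollow N (T.verts w)

inductive IsForced (T : Cotree G) (N : Set V) : T.tree → Prop
  | full (u : T.tree) : IsFull N (T.verts u) → IsForced T N u
  | parallel (u : T.tree) : T.kind u = NodeKind.parallel →
      (∀ v, u ⋖ v → ¬ IsHollow N (T.verts v)) → IsForced T N u
  | series (u : T.tree) : T.kind u = NodeKind.series →
      (∀ v, u ⋖ v → IsForced T N v) → IsForced T N u

end Cotree

end CographCompletion

/-! A completion is determined by the set `M ⊇ N` of neighbours of the new vertex. Two facts link
such sets to the cotree. If `M` is uniform on the children of `u` and is dictated by `u` outside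
`V(u)`, the graph is a cograph (`isCograph_addVertex`). Conversely, in a cograph every mixed node
has an insertion node below it (`exists_isInsertionNode`).

Necessity: a neighbour branching off at a parallel ancestor contradicts the insertion node; if `u`
is hollow, deleting `V(u)` from `M` gives a smaller completion; forcedness pushes fullness onto
every candidate node below `u`. Sufficiency: from `u`, descend through non-forced children of series
nodes until a node has a hollow child, and insert there. Among the sets with an insertion node below
`u`, a minimal one is minimal among all completions: a smaller completion still leaves `u` mixed, so
its insertion node is again below `u`. -/

namespace CographCompletion

open SimpleGraph

/-! ### Induced paths on four vertices -/

section Path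

variable {W : Type*} {H : SimpleGraph W}

/-- A path on four vertices has no partition into two nonempty parts with all edges, or no edges,
between them. -/
theorem pathGraph_four_no_homogeneous_cut (f : pathGraph 4 ↪g H) (A : W → Prop) (k : Prop)
    (i j : Fin 4) (hi : A (f i)) (hj : ¬ A (f j))
    (h : ∀ i j, A (f i) → ¬ A (f j) → (H.Adj (f i) (f j) ↔ k)) : False := by
  classical
  -- The path and its complement are both connected; `decide` checks this over all two-colourings.
  have key : ∀ (B : Fin 4 → Bool) (l : Bool), (∃ i, B i = true) → (∃ j, B j = false) →
      ¬ ∀ i j : Fin 4, B i = true → B j = false →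
        ((i.val + 1 = j.val ∨ j.val + 1 = i.val) ↔ l = true) := by decide
  refine key (fun i => decide (A (f i))) (decide k) ⟨i, by simpa using hi⟩ ⟨j, by simpa using hj⟩ ?_
  intro i j hi hj
  rw [← pathGraph_adj, ← f.map_adj_iff, h i j (by simpa using hi) (by simpa using hj)]
  simp

theorem IsCograph.not_path (hH : IsCograph H) {a b c d : W} (hab : H.Adj a b) (hbc : H.Adj b c)
    (hcd : H.Adj c d) (hac : ¬ H.Adj a c) (hbd : ¬ H.Adj b d) (had : ¬ H.Adj a d) : False := by
  have nab := hab.ne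
  have nbc := hbc.ne
  have ncd := hcd.ne
  have nac : a ≠ c := by rintro rfl; exact had hcd
  have nad : a ≠ d := by rintro rfl; exact hac hcd.symm
  have nbd : b ≠ d := by rintro rfl; exact had hab
  refine hH ⟨⟨⟨![a, b, c, d], ?_⟩, ?_⟩⟩
  · intro i j hij
    fin_cases i <;> fin_cases j <;> simp_all
  · intro i j
    change H.Adj (![a, b, c, d] i) (![a, b, c, d] j) ↔ _
    rw [pathGraph_adj]
    fin_cases i <;> fin_cases j <;>
      simp [hab, hbc, hcd, hac, hbd, had, hab.symm, hbc.symm, hcd.symm, H.adj_comm c a,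
        H.adj_comm d b, H.adj_comm d a]

end Path

/-! ### Completions as sets of neighbours -/

section Completion

variable {V : Type*} {G : SimpleGraph V} {N S : Set V}

theorem not_isHollow_iff : ¬ IsHollow N S ↔ ∃ y ∈ S, y ∈ N := by
  rw [IsHollow, ← ne_eq, ← Set.nonempty_iff_ne_empty]; rfl

theorem IsHollow.notMem (h : IsHollow N S) {y : V} (hy : y ∈ S) : y ∉ N :=
  fun hN => not_isHollow_iff.2 ⟨y, hy, hN⟩ h

theorem not_isFull_iff : ¬ IsFull N S ↔ ∃ y ∈ S, y ∉ N := Set.not_subset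

theorem not_isMixed_iff : ¬ IsMixed N S ↔ IsUniform N S := by
  unfold IsMixed IsUniform; tauto

theorem IsUniform.isFull (h : IsUniform N S) {y : V} (hy : y ∈ S) (hN : y ∈ N) : IsFull N S :=
  h.resolve_right fun h' => h'.notMem hy hN

theorem IsUniform.mem_iff (h : IsUniform N S) {y z : V} (hy : y ∈ S) (hz : z ∈ S) :
    y ∈ N ↔ z ∈ N :=
  ⟨fun hN => h.isFull hy hN hz, fun hN => h.isFull hz hN hy⟩

theorem IsUniform.mono (h : IsUniform N S) {S' : Set V} (hS : S' ⊆ S) : IsUniform N S' :=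
  h.imp (fun h => hS.trans h) fun h => Set.subset_empty_iff.1 (by
    rw [← h]; exact Set.inter_subset_inter_left _ hS)

theorem addVertex_le_addVertex_iff {N' : Set V} :
    addVertex G N ≤ addVertex G N' ↔ N ⊆ N' := by
  refine ⟨fun h y hy => h (show (addVertex G N).Adj none (some y) from hy), fun h => ?_⟩
  rintro (_ | y) (_ | z) hyz
  · exact hyz
  · exact h hyz
  · exact h hyz
  · exact hyz

theorem IsCompletion.eq_addVertex {H : SimpleGraph (Option V)} (h : IsCompletion G N H) :
    H = addVertex G (newNeighbors H) := by
  ext a b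
  rcases a with _ | y <;> rcases b with _ | z
  · exact ⟨fun h' => (H.irrefl h').elim, False.elim⟩
  · exact Iff.rfl
  · exact H.adj_comm _ _
  · exact ⟨h.2.1 y z, fun h' => h.1 (show (addVertex G N).Adj (some y) (some z) from h')⟩

theorem isCompletion_addVertex_iff {N' : Set V} :
    IsCompletion G N (addVertex G N') ↔ N ⊆ N' ∧ IsCograph (addVertex G N') :=
  ⟨fun h => ⟨addVertex_le_addVertex_iff.1 h.1, h.2.2⟩,
    fun h => ⟨addVertex_le_addVertex_iff.2 h.1, fun _ _ h => h, h.2⟩⟩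

theorem minimal_isCompletion_addVertex_iff {N' : Set V} :
    Minimal (IsCompletion G N) (addVertex G N') ↔
      Minimal (fun M => N ⊆ M ∧ IsCograph (addVertex G M)) N' := by
  refine ⟨fun h => ⟨isCompletion_addVertex_iff.1 h.prop, fun M hM hle => ?_⟩,
    fun h => ⟨isCompletion_addVertex_iff.2 h.prop, fun H hH hle => ?_⟩⟩
  · exact addVertex_le_addVertex_iff.1
      (h.le_of_le (isCompletion_addVertex_iff.2 hM) (addVertex_le_addVertex_iff.2 hle))
  · obtain ⟨M, rfl⟩ : ∃ M, H = addVertex G M := ⟨_, hH.eq_addVertex⟩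
    exact addVertex_le_addVertex_iff.2
      (h.le_of_le (isCompletion_addVertex_iff.1 hH) (addVertex_le_addVertex_iff.1 hle))

end Completion

/-! ### Order and leaves of the cotree -/

namespace Cotree

variable {V : Type*} {G : SimpleGraph V} {T : Cotree G} {N : Set V}

theorem verts_anti {u v : T.tree} (h : u ≤ v) : T.verts v ⊆ T.verts u := fun _ hy => h.trans hy

theorem le_total_of_le {a b c : T.tree} (ha : a ≤ c) (hb : b ≤ c) : a ≤ b ∨ b ≤ a :=
  le_total_of_directed hb ha

theorem exists_child_le {u v : T.tree} (h : u < v) : ∃ c, u ⋖ c ∧ c ≤ v :=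
  have := T.finite_tree
  exists_covBy_le_of_lt h

/-- Two nodes that are not below the same child of `u` have lowest common ancestor `u`. -/
theorem inf_eq_of_child {u c a b : T.tree} (hc : u ⋖ c) (ha : c ≤ a) (hb : u ≤ b)
    (hcb : ¬ c ≤ b) : a ⊓ b = u := by
  rcases le_total_of_le (inf_le_left : a ⊓ b ≤ a) ha with h | h
  · have hu : u ≤ a ⊓ b := le_inf (hc.le.trans ha) hb
    refine (hu.eq_of_not_lt fun hlt => hc.2 hlt (h.lt_of_ne ?_)).symm
    rintro rfl
    exact hcb inf_le_right
  · exact (hcb (h.trans inf_le_right)).elim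

/-- If `a` and `u` separate strictly later than `b` and `u`, then `b` separates from `a` where it
separates from `u`. -/
theorem inf_eq_of_inf_lt {a b u : T.tree} (h : b ⊓ u < a ⊓ u) : b ⊓ a = b ⊓ u := by
  rcases le_total_of_le (inf_le_right : b ⊓ a ≤ a) (inf_le_left : a ⊓ u ≤ a) with h' | h'
  · exact le_antisymm (le_inf inf_le_left (h'.trans inf_le_right))
      (le_inf inf_le_left (h.le.trans inf_le_left))
  · exact (h.not_ge (le_inf (h'.trans inf_le_left) inf_le_right)).elim

/-- Ancestors of `v` form a chain, so a meet with `v` that is not above `u` in the tree would put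
`a` below `u`. -/
theorem inf_eq_inf_of_le {a u v : T.tree} (huv : u ≤ v) (h : ¬ u ≤ a) : a ⊓ v = a ⊓ u := by
  rcases le_total_of_le (inf_le_right : a ⊓ v ≤ v) huv with h' | h'
  · exact le_antisymm (le_inf inf_le_left h') (inf_le_inf_left a huv)
  · exact (h (h'.trans inf_le_left)).elim

theorem verts_nonempty (u : T.tree) : (T.verts u).Nonempty := by
  have := T.finite_tree
  obtain ⟨m, hum, hm⟩ := Set.Finite.exists_le_maximal (Set.toFinite (Set.univ : Set T.tree))
    (Set.mem_univ u)
  have : m ∈ Set.range T.leaf := by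
    rw [T.range_leaf]
    exact (T.kind_eq_leaf_iff m).2 fun b hb => hm.2 (Set.mem_univ b) hb
  obtain ⟨y, rfl⟩ := this
  exact ⟨y, hum⟩

theorem kind_ne_leaf_of_lt {u v : T.tree} (h : u < v) : T.kind u ≠ NodeKind.leaf := fun hk =>
  h.not_ge ((T.kind_eq_leaf_iff u).1 hk h.le)

theorem kind_eq_parallel {u : T.tree} (h : T.kind u ≠ .leaf) (h' : T.kind u ≠ .series) :
    T.kind u = .parallel := by
  cases hk : T.kind u <;> simp_all

theorem exists_child_not_le {u : T.tree} (h : T.kind u ≠ .leaf) (v : T.tree) :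
    ∃ c, u ⋖ c ∧ ¬ c ≤ v := by
  obtain ⟨c, d, hc, hd, hcd⟩ := T.two_children u h
  by_cases hcv : c ≤ v
  · refine ⟨d, hd, fun hdv => ?_⟩
    rcases le_total_of_le hcv hdv with h' | h'
    · exact hd.2 hc.lt (h'.lt_of_ne hcd)
    · exact hc.2 hd.lt (h'.lt_of_ne hcd.symm)
  · exact ⟨c, hc, hcv⟩

theorem isUniform_verts_of_leaf {u : T.tree} (h : T.kind u = .leaf) :
    IsUniform N (T.verts u) := by
  rw [← not_isMixed_iff]
  rintro ⟨h1, h2⟩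
  obtain ⟨y, hy, hyN⟩ := not_isFull_iff.1 h1
  obtain ⟨z, hz, hzN⟩ := not_isHollow_iff.1 h2
  have hm := (T.kind_eq_leaf_iff u).1 h
  rw [T.leaf_injective ((hm.eq_of_le hy).symm.trans (hm.eq_of_le hz))] at hyN
  exact hyN hzN

theorem lt_of_mem_verts {u : T.tree} (h : T.kind u ≠ .leaf) {y : V} (hy : y ∈ T.verts u) :
    u < T.leaf y := by
  refine lt_of_le_of_ne hy fun he => h ?_
  have : T.leaf y ∈ Set.range T.leaf := ⟨y, rfl⟩
  rw [T.range_leaf] at this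
  rw [he]; exact this

theorem exists_child_mem {u : T.tree} (h : T.kind u ≠ .leaf) {y : V} (hy : y ∈ T.verts u) :
    ∃ c, u ⋖ c ∧ y ∈ T.verts c :=
  exists_child_le (lt_of_mem_verts h hy)

/-- Leaves below `u` that behave differently are separated by `u` when its children are uniform. -/
theorem inf_eq_of_uniform_children {u : T.tree} (h : ∀ c, u ⋖ c → IsUniform N (T.verts c))
    {y z : V} (hy : y ∈ T.verts u) (hz : z ∈ T.verts u) (hyN : y ∈ N) (hzN : z ∉ N) :
    T.leaf y ⊓ T.leaf z = u := by
  have hk : T.kind u ≠ .leaf := fun hk =>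
    hzN (((isUniform_verts_of_leaf hk).mem_iff hy hz).1 hyN)
  obtain ⟨c, hc, hyc⟩ := exists_child_mem hk hy
  exact inf_eq_of_child hc hyc hz fun hzc => hzN (((h c hc).mem_iff hyc hzc).1 hyN)

/-! ### Insertion nodes and cographs -/

/-- The new vertex can be inserted at a node `u` whose children are uniform. -/
theorem isCograph_addVertex (hG : IsCograph G) {u : T.tree}
    (hu : ∀ c, u ⋖ c → IsUniform N (T.verts c))
    (hout : ∀ y, y ∉ T.verts u → (y ∈ N ↔ T.kind (T.leaf y ⊓ u) = .series)) :
    IsCograph (addVertex G N) := by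
  rintro ⟨f⟩
  have adj_iff {y z : V} (m : T.tree) (hyz : y ≠ z) (hm : T.leaf y ⊓ T.leaf z = m) :
      (addVertex G N).Adj (some y) (some z) ↔ T.kind m = .series := by
    rw [← hm]; exact T.adj_iff y z hyz
  by_cases hx : ∃ i, f i = none
  swap
  · have hx' : ∀ i, ∃ y, f i = some y := fun i => Option.ne_none_iff_exists'.1 fun h => hx ⟨i, h⟩
    choose g hg using hx'
    refine hG ⟨⟨⟨g, fun i j hij => f.injective (by rw [hg, hg, hij])⟩, ?_⟩⟩
    intro i j
    rw [← f.map_adj_iff, hg, hg]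
    exact Iff.rfl
  obtain ⟨i₀, hi₀⟩ := hx
  -- For a path inside `V(u)` and `x`, cut off `x` if it treats all the others alike. Otherwise cut
  -- off the neighbours of `x` when `u` is series, and the non-neighbours when it is not.
  by_cases hins : ∀ i y, f i = some y → y ∈ T.verts u
  · have hsome : ∃ j y, f j = some y := by
      refine ⟨i₀ + 1, Option.ne_none_iff_exists'.1 fun h => ?_⟩
      have := f.injective (hi₀.trans h.symm)
      have hne : ∀ i : Fin 4, i ≠ i + 1 := by decide
      exact hne i₀ this
    obtain ⟨j₀, y₀, hj₀⟩ := hsome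
    by_cases hunif : ∀ i j y z, f i = some y → f j = some z → (y ∈ N ↔ z ∈ N)
    · refine pathGraph_four_no_homogeneous_cut f (fun a => a = none) (y₀ ∈ N) i₀ j₀ hi₀
        (by simp [hj₀]) ?_
      intro i j hi hj
      obtain ⟨z, hz⟩ := Option.ne_none_iff_exists'.1 hj
      rw [hi, hz]
      exact hunif j j₀ z y₀ hz hj₀
    · push Not at hunif
      have hmix : ∃ i j y z, f i = some y ∧ f j = some z ∧ y ∈ N ∧ z ∉ N := by
        obtain ⟨i, j, y, z, hi, hj, h⟩ := hunif
        rcases h with ⟨h, h'⟩ | ⟨h, h'⟩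
        · exact ⟨i, j, y, z, hi, hj, h, h'⟩
        · exact ⟨j, i, z, y, hj, hi, h', h⟩
      obtain ⟨i₁, i₂, y₁, y₂, h₁, h₂, hy₁, hy₂⟩ := hmix
      by_cases hs : T.kind u = .series
      · refine pathGraph_four_no_homogeneous_cut f (fun a => ∃ y ∈ N, a = some y) True i₁ i₂
          ⟨y₁, hy₁, h₁⟩ (by rintro ⟨y, hy, h⟩; rw [h₂] at h; cases h; exact hy₂ hy) ?_
        rintro i j ⟨y, hy, hi⟩ hj
        rw [hi]
        rcases hfj : f j with _ | z
        · exact iff_of_true hy trivial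
        · have hz : z ∉ N := fun hz => hj ⟨z, hz, hfj⟩
          rw [adj_iff u (by rintro rfl; exact hz hy)
            (inf_eq_of_uniform_children hu (hins i y hi) (hins j z hfj) hy hz)]
          simp [hs]
      · refine pathGraph_four_no_homogeneous_cut f (fun a => ∃ y ∉ N, a = some y) False i₂ i₁
          ⟨y₂, hy₂, h₂⟩ (by rintro ⟨y, hy, h⟩; rw [h₁] at h; cases h; exact hy hy₁) ?_
        rintro i j ⟨y, hy, hi⟩ hj
        rw [hi]
        rcases hfj : f j with _ | z
        · exact iff_of_false hy id
        · have hz : z ∈ N := by_contra fun hz => hj ⟨z, hz, hfj⟩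
          rw [adj_iff u (by rintro rfl; exact hy hz)
            ((inf_comm _ _).trans
              (inf_eq_of_uniform_children hu (hins j z hfj) (hins i y hi) hz hy))]
          simp [hs]
  · push Not at hins
    obtain ⟨j₁, y₁, hj₁, hy₁⟩ := hins
    -- Some path vertex lies outside `V(u)`. Take the branching point `m` nearest the root: the
    -- vertices branching off there see all others, including `x`, according to the label of `m`.
    obtain ⟨m, hm⟩ : ∃ m, Minimal (fun m => m < u ∧ ∃ i y, f i = some y ∧ T.leaf y ⊓ u = m) m := by
      have := T.finite_tree
      exact (Set.toFinite {m | m < u ∧ ∃ i y, f i = some y ∧ T.leaf y ⊓ u = m}).exists_minimal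
        ⟨_, inf_lt_right.2 hy₁, j₁, y₁, hj₁, rfl⟩
    obtain ⟨⟨hmu, j, y, hj, hym⟩, hmin⟩ := hm
    have hle : ∀ i z, f i = some z → m ≤ T.leaf z ⊓ u := by
      intro i z hi
      rcases le_total_of_le (inf_le_right : T.leaf z ⊓ u ≤ u) hmu.le with h | h
      · exact hmin ⟨h.trans_lt hmu, i, z, hi, rfl⟩ h
      · exact h
    refine pathGraph_four_no_homogeneous_cut f (fun a => ∃ y, a = some y ∧ T.leaf y ⊓ u = m)
      (T.kind m = .series) j i₀ ⟨y, hj, hym⟩ (by simp [hi₀]) ?_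
    rintro i k ⟨z, hi, hzm⟩ hk
    rw [hi]
    rcases hfk : f k with _ | w
    · rw [← hzm]
      exact hout z (inf_lt_right.1 (hzm.trans_lt hmu))
    · have hw : T.leaf w ⊓ u ≠ m := fun hw => hk ⟨w, hfk, hw⟩
      refine adj_iff m (by rintro rfl; exact hw hzm) ?_
      rw [← hzm]
      exact inf_eq_of_inf_lt (hzm.trans_lt ((hle k w hfk).lt_of_ne' hw))

/-- In a cograph `G + x`, every mixed node has the insertion node below it. -/
theorem exists_isInsertionNode (hN : IsCograph (addVertex G N)) {u : T.tree}
    (hu : IsMixed N (T.verts u)) : ∃ v, u ≤ v ∧ T.IsInsertionNode N v := by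
  have := T.finite_tree
  -- Maximal in the order means a deepest mixed node, so its children are uniform.
  obtain ⟨v, huv, hv⟩ :=
    (Set.toFinite {v : T.tree | IsMixed N (T.verts v)}).exists_le_maximal hu
  have hmix : IsMixed N (T.verts v) := hv.prop
  have hchild : ∀ c, v ⋖ c → IsUniform N (T.verts c) := fun c hc =>
    not_isMixed_iff.1 fun h => hc.lt.not_ge (hv.le_of_ge h hc.le)
  refine ⟨v, huv, hmix, hchild, fun y hy => ?_⟩
  obtain ⟨b, hb, hbN⟩ := not_isFull_iff.1 hmix.1
  obtain ⟨a, ha, haN⟩ := not_isHollow_iff.1 hmix.2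
  have hab : T.leaf a ⊓ T.leaf b = v := inf_eq_of_uniform_children hchild ha hb haN hbN
  have hvk : T.kind v ≠ .leaf := fun hk =>
    (not_isMixed_iff.2 (isUniform_verts_of_leaf hk)) hmix
  set w := T.leaf y ⊓ v with hw
  have hwv : w < v := inf_lt_right.2 hy
  have hwy : w ≤ T.leaf y := inf_le_left
  have adj_iff {p q : V} {m : T.tree} (hm : T.leaf p ⊓ T.leaf q = m) (hpq : p ≠ q) :
      (addVertex G N).Adj (some p) (some q) ↔ T.kind m = .series := by
    rw [← hm]; exact T.adj_iff p q hpq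
  have ne_of {p q : V} {m : T.tree} (hp : m ≤ T.leaf p) (hq : ¬ m ≤ T.leaf q) : p ≠ q := by
    rintro rfl; exact hq hp
  have habne : a ≠ b := by rintro rfl; exact hbN haN
  have hya : T.leaf y ⊓ T.leaf a = w := inf_eq_inf_of_le ha hy
  have hyb : T.leaf y ⊓ T.leaf b = w := inf_eq_inf_of_le hb hy
  have Aab := adj_iff hab habne
  have Aya := adj_iff hya (ne_of ha hy).symm
  have Ayb := adj_iff hyb (ne_of hb hy).symm
  -- a leaf `z` separated from `v` at the parent `p` of `v`, when `p` lies strictly below `w`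
  have sibling : T.kind w = T.kind v → ∃ z, T.kind (T.leaf z ⊓ v) ≠ T.kind v ∧
      T.kind (T.leaf z ⊓ v) ≠ .leaf ∧ z ∉ T.verts v ∧ T.leaf y ⊓ T.leaf z = w ∧ y ≠ z := by
    intro hk
    obtain ⟨p, hwp, hpv⟩ := exists_le_covBy_of_lt hwv
    have hpk : T.kind p ≠ T.kind v := by
      intro h
      rcases hvk' : T.kind v with _ | _ | _
      · exact hvk hvk'
      · exact T.no_adjacent_parallel p v hpv (h.trans hvk') hvk'
      · exact T.no_adjacent_series p v hpv (h.trans hvk') hvk'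
    have hpleaf := kind_ne_leaf_of_lt hpv.lt
    obtain ⟨c, hc, hcv⟩ := exists_child_not_le hpleaf v
    obtain ⟨z, hz⟩ := T.verts_nonempty c
    have hzv : T.leaf z ⊓ v = p := inf_eq_of_child hc hz hpv.le hcv
    have hwp' : w < p := hwp.lt_of_ne (by rintro rfl; exact hpk hk)
    have hyz : T.leaf y ⊓ T.leaf z = w := by
      have : T.leaf y ⊓ v < T.leaf z ⊓ v := by rw [hzv]; exact hwp'
      exact inf_eq_of_inf_lt this
    refine ⟨z, by rwa [hzv], by rwa [hzv], fun h => ?_, hyz, ?_⟩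
    · exact hpv.lt.ne (hzv.symm.trans (inf_eq_right.2 h))
    · rintro rfl
      exact hwp'.ne (hw.trans hzv)
  by_contra hcon
  rw [not_iff] at hcon
  have hwk : T.kind w ≠ .leaf := kind_ne_leaf_of_lt hwv
  have xa : (addVertex G N).Adj none (some a) := haN
  have xb : ¬ (addVertex G N).Adj none (some b) := hbN
  -- If `y` violates the condition, the labels of `w` and `v` decide the induced path: `x a y b` for
  -- series over parallel, `y x a b` for parallel over series. For equal labels, `z` from `sibling`
  -- supplies the missing alternation.
  by_cases hs : T.kind w = .series
  · have xy : ¬ (addVertex G N).Adj none (some y) := hcon.2 hs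
    replace Aya := (Aya.2 hs)
    replace Ayb := (Ayb.2 hs)
    by_cases hvs : T.kind v = .series
    · obtain ⟨z, hz, -, hzv, hyz, hne⟩ := sibling (hs.trans hvs.symm)
      have Ayz := (adj_iff hyz hne).2 hs
      rw [hvs] at hz
      have Aza := (adj_iff (inf_eq_inf_of_le ha hzv) (ne_of ha hzv).symm).not.2 hz
      have Azb := (adj_iff (inf_eq_inf_of_le hb hzv) (ne_of hb hzv).symm).not.2 hz
      by_cases hzN : z ∈ N
      · have xz : (addVertex G N).Adj none (some z) := hzN
        exact hN.not_path xz Ayz.symm Ayb xy Azb xb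
      · have xz : ¬ (addVertex G N).Adj none (some z) := hzN
        exact hN.not_path xa Aya.symm Ayz xy (mt SimpleGraph.Adj.symm Aza) xz
    · exact hN.not_path xa Aya.symm Ayb xy (Aab.not.2 hvs) xb
  · have xy : (addVertex G N).Adj none (some y) := not_not.1 (hcon.not.2 hs)
    replace Aya := (Aya.not.2 hs)
    replace Ayb := (Ayb.not.2 hs)
    by_cases hvs : T.kind v = .series
    · exact hN.not_path xy.symm xa (Aab.2 hvs) Aya xb Ayb
    · have hvp := kind_eq_parallel hvk hvs
      obtain ⟨z, hz, hzl, hzv, hyz, hne⟩ := sibling ((kind_eq_parallel hwk hs).trans hvp.symm)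
      have Ayz := (adj_iff hyz hne).not.2 hs
      have hz' : T.kind (T.leaf z ⊓ v) = .series :=
        by_contra fun h => hz ((kind_eq_parallel hzl h).trans hvp.symm)
      have Aza := (adj_iff (inf_eq_inf_of_le ha hzv) (ne_of ha hzv).symm).2 hz'
      have Azb := (adj_iff (inf_eq_inf_of_le hb hzv) (ne_of hb hzv).symm).2 hz'
      by_cases hzN : z ∈ N
      · have xz : (addVertex G N).Adj none (some z) := hzN
        exact hN.not_path xy.symm xz Azb Ayz xb Ayb
      · have xz : ¬ (addVertex G N).Adj none (some z) := hzN
        exact hN.not_path xy.symm xa Aza.symm Aya xz Ayz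

/-! ### Forced and eligible nodes -/

theorem not_isHollow_of_le {u v : T.tree} (h : u ≤ v) (hv : ¬ IsHollow N (T.verts v)) :
    ¬ IsHollow N (T.verts u) := by
  obtain ⟨y, hy, hyN⟩ := not_isHollow_iff.1 hv
  exact not_isHollow_iff.2 ⟨y, verts_anti h hy, hyN⟩

theorem IsForced.not_isHollow {u : T.tree} (h : T.IsForced N u) : ¬ IsHollow N (T.verts u) := by
  induction h with
  | full u h =>
    obtain ⟨y, hy⟩ := T.verts_nonempty u
    exact not_isHollow_iff.2 ⟨y, hy, h hy⟩
  | parallel u hk h =>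
    obtain ⟨c, -, hc, -⟩ := T.two_children u (by simp [hk])
    exact not_isHollow_of_le hc.le (h c hc)
  | series u hk h ih =>
    obtain ⟨c, -, hc, -⟩ := T.two_children u (by simp [hk])
    exact not_isHollow_of_le hc.le (ih c hc)

theorem IsInsertionNode.isFull_of_children {M : Set V} (hNM : N ⊆ M) {u : T.tree}
    (h : T.IsInsertionNode M u) (hk : T.kind u ≠ .leaf)
    (hc : ∀ c, u ⋖ c → ¬ IsHollow N (T.verts c)) : IsFull M (T.verts u) := by
  intro y hy
  obtain ⟨c, huc, hyc⟩ := exists_child_mem hk hy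
  obtain ⟨z, hz, hzN⟩ := not_isHollow_iff.1 (hc c huc)
  exact (h.2.1 c huc).isFull hz (hNM hzN) hyc

/-- At a parallel node, an insertion node strictly inside one child would make the neighbours in the
other children non-neighbours; insertion at the node itself would fill all its children. -/
theorem IsForced.not_isInsertionNode {M : Set V} (hNM : N ⊆ M) {u : T.tree}
    (h : T.IsForced N u) : ∀ v, u ≤ v → ¬ T.IsInsertionNode M v := by
  induction h with
  | full u h => exact fun v huv hv => hv.1.1 ((verts_anti huv).trans (h.trans hNM))
  | parallel u hk h =>
    intro v huv hv
    have hk' : T.kind u ≠ .leaf := by simp [hk]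
    rcases huv.eq_or_lt with rfl | huv
    · exact hv.1.1 (hv.isFull_of_children hNM hk' h)
    · obtain ⟨c, hc, hcv⟩ := exists_child_not_le hk' v
      obtain ⟨y, hy, hyN⟩ := not_isHollow_iff.1 (h c hc)
      have hyv : T.leaf y ⊓ v = u := inf_eq_of_child hc hy huv.le hcv
      have := (hv.2.2 y fun h => huv.ne (hyv.symm.trans (inf_eq_right.2 h))).1 (hNM hyN)
      rw [hyv, hk] at this
      cases this
  | series u hk h ih =>
    intro v huv hv
    rcases huv.eq_or_lt with rfl | huv
    · exact hv.1.1 (hv.isFull_of_children hNM (by simp [hk]) fun c hc => (h c hc).not_isHollow)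
    · obtain ⟨c, hc, hcv⟩ := exists_child_le huv
      exact ih c hc v hcv hv

theorem IsEligible.kind_inf {u : T.tree} (h : T.IsEligible N u) {y : V} (hy : y ∉ T.verts u)
    (hyN : y ∈ N) : T.kind (T.leaf y ⊓ u) = .series := by
  have hlt : T.leaf y ⊓ u < u := inf_lt_right.2 hy
  by_contra hs
  have hk := kind_ne_leaf_of_lt hlt
  obtain ⟨c, hc, hyc⟩ := exists_child_mem hk (inf_le_left : T.leaf y ⊓ u ≤ T.leaf y)
  exact (h _ hlt (kind_eq_parallel hk hs) c hc
    fun hcu => hc.lt.not_ge (le_inf hyc hcu)).notMem hyc hyN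

/-- A set of full children of an eligible node that covers the neighbourhood, but not all of the
children, determines a completion with this insertion node. -/
theorem IsEligible.exists_isInsertionNode {u : T.tree} (h : T.IsEligible N u) (F : Set T.tree)
    (hF : ∀ c, u ⋖ c → ¬ IsHollow N (T.verts c) → c ∈ F) (hk : T.kind u ≠ .leaf)
    (h₁ : ∃ c, u ⋖ c ∧ c ∈ F) (h₂ : ∃ c, u ⋖ c ∧ c ∉ F) :
    ∃ M, N ⊆ M ∧ T.IsInsertionNode M u := by
  have huniq {c d : T.tree} {y : V} (hc : u ⋖ c) (hd : u ⋖ d) (hyc : y ∈ T.verts c)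
      (hyd : y ∈ T.verts d) : c = d := by
    rcases le_total_of_le hyc hyd with h' | h'
    · exact h'.eq_of_not_lt fun h' => hd.2 hc.lt h'
    · exact (h'.eq_of_not_lt fun h' => hc.2 hd.lt h').symm
  have hin : ∀ c y, u ⋖ c → y ∈ T.verts c →
      (((∃ c ∈ F, u ⋖ c ∧ y ∈ T.verts c) ∨
        (y ∉ T.verts u ∧ T.kind (T.leaf y ⊓ u) = .series)) ↔ c ∈ F) := by
    intro c y hc hy
    constructor
    · rintro (⟨d, hd, hud, hyd⟩ | ⟨hyu, -⟩)
      · rwa [huniq hc hud hy hyd]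
      · exact (hyu (verts_anti hc.le hy)).elim
    · exact fun hcF => Or.inl ⟨c, hcF, hc, hy⟩
  -- Below `u` the set is the union of the children in `F`; outside, the definition of insertion
  -- node leaves no choice.
  refine ⟨{y | (∃ c ∈ F, u ⋖ c ∧ y ∈ T.verts c) ∨
    (y ∉ T.verts u ∧ T.kind (T.leaf y ⊓ u) = .series)}, ?_, ⟨?_, ?_⟩, ?_, ?_⟩
  · intro y hyN
    by_cases hy : y ∈ T.verts u
    · obtain ⟨c, hc, hyc⟩ := exists_child_mem hk hy
      exact (hin c y hc hyc).2 (hF c hc (not_isHollow_iff.2 ⟨y, hyc, hyN⟩))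
    · exact Or.inr ⟨hy, h.kind_inf hy hyN⟩
  · obtain ⟨c, hc, hcF⟩ := h₂
    obtain ⟨y, hy⟩ := T.verts_nonempty c
    exact not_isFull_iff.2 ⟨y, verts_anti hc.le hy, fun hy' => hcF ((hin c y hc hy).1 hy')⟩
  · obtain ⟨c, hc, hcF⟩ := h₁
    obtain ⟨y, hy⟩ := T.verts_nonempty c
    exact not_isHollow_iff.2 ⟨y, verts_anti hc.le hy, (hin c y hc hy).2 hcF⟩
  · intro c hc
    by_cases hcF : c ∈ F
    · exact Or.inl fun y hy => (hin c y hc hy).2 hcF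
    · refine Or.inr (not_not.1 fun hh => ?_)
      obtain ⟨y, hy, hyM⟩ := not_isHollow_iff.1 hh
      exact hcF ((hin c y hc hy).1 hyM)
  · intro y hy
    refine ⟨?_, fun hs => Or.inr ⟨hy, hs⟩⟩
    rintro (⟨c, -, hc, hyc⟩ | h)
    · exact (hy (verts_anti hc.le hyc)).elim
    · exact h.2

theorem exists_isInsertionNode_of_not_isForced (u : T.tree) (he : T.IsEligible N u)
    (hh : ¬ IsHollow N (T.verts u)) (hf : ¬ T.IsForced N u) :
    ∃ M v, N ⊆ M ∧ u ≤ v ∧ T.IsInsertionNode M v := by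
  have := T.finite_tree
  induction u using (wellFounded_gt (α := T.tree)).induction with
  | _ u ih =>
  have hfull : ¬ IsFull N (T.verts u) := fun h => hf (.full u h)
  have hk : T.kind u ≠ .leaf := fun hk =>
    (isUniform_verts_of_leaf (N := N) hk).elim hfull hh
  have hnonhollow : ∃ c, u ⋖ c ∧ ¬ IsHollow N (T.verts c) := by
    obtain ⟨y, hy, hyN⟩ := not_isHollow_iff.1 hh
    obtain ⟨c, hc, hyc⟩ := exists_child_mem hk hy
    exact ⟨c, hc, not_isHollow_iff.2 ⟨y, hyc, hyN⟩⟩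
  have insert_here (F : Set T.tree) (hF : ∀ c, u ⋖ c → ¬ IsHollow N (T.verts c) → c ∈ F)
      (h₂ : ∃ c, u ⋖ c ∧ c ∉ F) : ∃ M v, N ⊆ M ∧ u ≤ v ∧ T.IsInsertionNode M v := by
    obtain ⟨c, hc, hcN⟩ := hnonhollow
    obtain ⟨M, hM, hu⟩ := he.exists_isInsertionNode F hF hk ⟨c, hc, hF c hc hcN⟩ h₂
    exact ⟨M, u, hM, le_rfl, hu⟩
  have hhollow : (∃ c, u ⋖ c ∧ IsHollow N (T.verts c)) →
      ∃ M v, N ⊆ M ∧ u ≤ v ∧ T.IsInsertionNode M v := fun ⟨c, hc, hcN⟩ =>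
    insert_here {c | ¬ IsHollow N (T.verts c)} (fun _ _ h => h) ⟨c, hc, fun h => h hcN⟩
  by_cases hs : T.kind u = .series
  · obtain ⟨c, hc, hcf⟩ : ∃ c, u ⋖ c ∧ ¬ T.IsForced N c := by
      by_contra hcon
      push Not at hcon
      exact hf (.series u hs hcon)
    by_cases hcN : IsHollow N (T.verts c)
    · exact hhollow ⟨c, hc, hcN⟩
    · have hce : T.IsEligible N c := by
        intro v hv hvk w hw hwc
        have hvu : v ≤ u := by
          rcases le_total_of_le hv.le hc.le with h | h
          · exact h
          · exact (h.eq_of_not_lt fun h => hc.2 h hv).ge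
        have hvu' : v ≠ u := by rintro rfl; rw [hs] at hvk; cases hvk
        exact he v (hvu.lt_of_ne hvu') hvk w hw fun h => hwc (h.trans hc.le)
      obtain ⟨M, v, hM, hcv, hv⟩ := ih c hc.lt hce hcN hcf
      exact ⟨M, v, hM, hc.le.trans hcv, hv⟩
  · apply hhollow
    by_contra hcon
    push Not at hcon
    exact hf (.parallel u (kind_eq_parallel hk hs) hcon)

/-! ### Minimal completions -/

theorem isCompletionMinimalInsertionNode_iff {u : T.tree} :
    T.IsCompletionMinimalInsertionNode N u ↔
      ∃ M, Minimal (fun M => N ⊆ M ∧ IsCograph (addVertex G M)) M ∧ T.IsInsertionNode M u := by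
  constructor
  · rintro ⟨H, hH, hu⟩
    refine ⟨newNeighbors H, ?_, hu⟩
    rw [← minimal_isCompletion_addVertex_iff, ← hH.prop.eq_addVertex]
    exact hH
  · rintro ⟨M, hM, hu⟩
    exact ⟨addVertex G M, minimal_isCompletion_addVertex_iff.2 hM, hu⟩

theorem IsInsertionNode.isEligible {M : Set V} (hNM : N ⊆ M) {u v : T.tree} (huv : u ≤ v)
    (hv : T.IsInsertionNode M v) : T.IsEligible N u := by
  intro w hw hk c hc hcu
  refine not_not.1 fun hh => ?_
  obtain ⟨y, hy, hyN⟩ := not_isHollow_iff.1 hh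
  have hyu : T.leaf y ⊓ u = w := inf_eq_of_child hc hy hw.le hcu
  have hyu' : y ∉ T.verts u := fun h => hw.ne (hyu.symm.trans (inf_eq_right.2 h))
  have := (hv.2.2 y fun h => hyu' (huv.trans h)).1 (hNM hyN)
  rw [inf_eq_inf_of_le huv hyu', hyu, hk] at this
  cases this

theorem not_isHollow_of_minimal (hG : IsCograph G) {M : Set V}
    (hM : Minimal (fun M => N ⊆ M ∧ IsCograph (addVertex G M)) M) {u v : T.tree} (huv : u ≤ v)
    (hv : T.IsInsertionNode M v) : ¬ IsHollow N (T.verts u) := by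
  intro hh
  obtain ⟨y, hy, hyM⟩ := not_isHollow_iff.1 hv.1.2
  have hsub : N ⊆ M \ T.verts u := fun z hz => ⟨hM.prop.1 hz, fun h => hh.notMem h hz⟩
  have hhollow : IsHollow (M \ T.verts u) (T.verts u) := by
    ext z; simp
  have hco : IsCograph (addVertex G (M \ T.verts u)) := by
    -- `u` is hollow for the smaller set, hence no insertion node, but `isCograph_addVertex` does
    -- not ask for a mixed node.
    refine isCograph_addVertex (u := u) hG (fun c hc => ?_) fun z hz => ?_
    · exact IsUniform.mono (Or.inr hhollow) (verts_anti hc.le)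
    · rw [← inf_eq_inf_of_le huv hz, ← hv.2.2 z fun h => hz (huv.trans h)]
      exact and_iff_left hz
  exact (hM.le_of_le ⟨hsub, hco⟩ Set.sdiff_subset hyM).2 (verts_anti huv hy)

theorem exists_isCompletionMinimalInsertionNode [Finite V] (hG : IsCograph G) {u : T.tree}
    (he : T.IsEligible N u) (hh : ¬ IsHollow N (T.verts u)) (hf : ¬ T.IsForced N u) :
    ∃ v, u ≤ v ∧ T.IsCompletionMinimalInsertionNode N v := by
  obtain ⟨M₀, v₀, h₀⟩ := exists_isInsertionNode_of_not_isForced u he hh hf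
  obtain ⟨M, hM⟩ :=
    (Set.toFinite {M | ∃ v, N ⊆ M ∧ u ≤ v ∧ T.IsInsertionNode M v}).exists_minimal ⟨M₀, v₀, h₀⟩
  obtain ⟨v, hNM, huv, hv⟩ := hM.prop
  refine ⟨v, huv, isCompletionMinimalInsertionNode_iff.2
    ⟨M, ⟨⟨hNM, isCograph_addVertex hG hv.2.1 hv.2.2⟩, ?_⟩, hv⟩⟩
  rintro M' ⟨hNM', hco⟩ hle
  -- Not full because `M' ⊆ M` and `v` is mixed for `M`; not hollow because `N ⊆ M'`.
  have hmix : IsMixed M' (T.verts u) := by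
    refine ⟨fun h => hv.1.1 ((verts_anti huv).trans (h.trans hle)), ?_⟩
    obtain ⟨y, hy, hyN⟩ := not_isHollow_iff.1 hh
    exact not_isHollow_iff.2 ⟨y, hy, hNM' hyN⟩
  obtain ⟨v', huv', hv'⟩ := T.exists_isInsertionNode hco hmix
  exact hM.le_of_le ⟨v', hNM', huv', hv'⟩ hle

end Cotree

end CographCompletion

theorem lemma5 {V : Type*} [Finite V] (G : SimpleGraph V)
    (hG : CographCompletion.IsCograph G) (T : CographCompletion.Cotree G)
    (N : Set V) (hN_nonempty : N.Nonempty) (hN_ne_univ : N ≠ Set.univ) (u : T.tree) :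
    (∃ v : T.tree, u ≤ v ∧ T.IsCompletionMinimalInsertionNode N v) ↔
      T.IsEligible N u ∧ ¬ CographCompletion.IsHollow N (T.verts u) ∧ ¬ T.IsForced N u := by
  constructor
  · rintro ⟨v, huv, hv⟩
    obtain ⟨M, hM, hv⟩ := CographCompletion.Cotree.isCompletionMinimalInsertionNode_iff.1 hv
    exact ⟨hv.isEligible hM.prop.1 huv,
      CographCompletion.Cotree.not_isHollow_of_minimal hG hM huv hv,
      fun hf => hf.not_isInsertionNode hM.prop.1 v huv hv⟩
  · rintro ⟨he, hh, hf⟩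
    exact CographCompletion.Cotree.exists_isCompletionMinimalInsertionNode hG he hh hf
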